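/- Let $N\ge 1$, let $\sigma_\theta^2\ge 0$, $\sigma_w^2>0$, $P_T>0$, $\gamma\in\mathbb R$, and for $i=1,\dots,N$ let $\sigma_{v,i}^2>0$ and $d_i>0$. Let the prediction mean square error $P_{n|n-1}$ and the threshold $\epsilon$ be fixed real numbers with $0<\epsilon<P_{n|n-1}$. Let $\tilde h_1,\dots,\tilde h_N$ be independent $\mathcal{CN}(0,1)$ random variables (circularly symmetric complex normal with $\mathbb E|\tilde h_i|^2=1$), and let the channel be $\mathbf h=(\tilde h_1/d_1^{\gamma},\dots,\tilde h_N/d_N^{\gamma})^T$, $\mathbf H=\mathrm{diag}(\mathbf h)$. Let $\mathbf V=\mathrm{diag}(\sigma_{v,1}^2,\dots,\sigma_{v,N}^2)$ and let $$\mathbf a_e=\sqrt{\tfrac{P_T}{N}}\left[\tfrac{1}{\sqrt{\sigma_\theta^2+\sigma_{v,1}^2}},\dots,\tfrac{1}{\sqrt{\sigma_\theta^2+\sigma_{v,N}^2}}\right]^T$$ be the equal-power transmit gain vector. The filtered mean square error of the Kalman filter is $$P_{n|n}=(1-k\,\mathbf a_e^H\mathbf h)\,P_{n|n-1},\qquad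 k=\frac{P_{n|n-1}\,\mathbf h^H\mathbf a_e}{\mathbf a_e^H\mathbf H\mathbf V\mathbf H^H\mathbf a_e+P_{n|n-1}\,\mathbf a_e^H\mathbf h\mathbf h^H\mathbf a_e+\sigma_w^2}.$$ Put $$\beta=\frac{P_{n|n-1}-\epsilon}{\epsilon P_{n|n-1}},\quad \tilde{\mathbf a}_e=\frac{\mathbf a_e}{\sqrt{P_T}},\quad \mathbf M=\mathrm{diag}\left\{\frac1{d_1^{\gamma}},\dots,\frac1{d_N^{\gamma}}\right\},\quad \mathbf Q=\mathrm{diag}\left\{\frac{\sigma_{v,i}^2}{N(\sigma_\theta^2+\sigma_{v,i}^2)d_i^{2\gamma}}\right\}_{i=1}^N,$$ and let $\lambda_1\ge\lambda_2\ge\dots\ge\lambda_N$ be the eigenvalues, with multiplicity, of the Hermitian matrix $\mathbf R=\mathbf M\tilde{\mathbf a}_e\tilde{\mathbf a}_e^H\mathbf M-\beta\mathbf Q$. Then $\lambda_i<0$ for $2\le i\le N$ (so only $\lambda_1$ can be positive), and the mean square error outage probability is $$\Pr\{P_{n|n}>\epsilon\}=\begin{cases}1-\dfrac{\lambda_1^{N-1}}{\prod_{l\ne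 1}(\lambda_1-\lambda_l)}\,\exp\left(-\dfrac{(P_{n|n-1}-\epsilon)\,\sigma_w^2}{\epsilon\,P_{n|n-1}\,P_T\,\lambda_1}\right), & \lambda_1>0,\\[2ex] 1, & \lambda_1\le 0.\end{cases}$$ -/

import Mathlib

open MeasureTheory ProbabilityTheory Matrix
open scoped NNReal ENNReal

namespace SensorNet

noncomputable section

/-- The circularly symmetric complex normal law `CN(0, v)`: real and imaginary parts are independent
centred real Gaussians, each of variance `v / 2` (so that the mean of `|z|²` is `v`). -/
def complexNormal (v : ℝ≥0) : Measure ℂ :=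
  ((gaussianReal 0 (v / 2)).prod (gaussianReal 0 (v / 2))).map fun p : ℝ × ℝ => (⟨p.1, p.2⟩ : ℂ)

variable {N : ℕ}

/-- The measurement noise covariance `V = diag(σ_{v,1}², …, σ_{v,N}²)`. -/
def noiseCov (σv2 : Fin N → ℝ) : Matrix (Fin N) (Fin N) ℂ :=
  Matrix.diagonal fun i => (σv2 i : ℂ)

/-- The denominator `aᴴ H V Hᴴ a + P aᴴ h hᴴ a + σ_w²` of the Kalman gain, with `H = diag h`;
`Ppred` is the prediction MSE. -/
def innovationVar (Ppred σw2 : ℝ) (σv2 : Fin N → ℝ) (a h : Fin N → ℂ) : ℂ :=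
  star a ⬝ᵥ ((Matrix.diagonal h * noiseCov σv2 * (Matrix.diagonal h)ᴴ) *ᵥ a)
    + Ppred * ((star a ⬝ᵥ h) * (star h ⬝ᵥ a)) + σw2

/-- The Kalman gain for the observation `y = aᴴ h θ + aᴴ H v + w`. -/
def kalmanGain (Ppred σw2 : ℝ) (σv2 : Fin N → ℝ) (a h : Fin N → ℂ) : ℂ :=
  Ppred * (star h ⬝ᵥ a) / innovationVar Ppred σw2 σv2 a h

/-- The filtered MSE `(1 - k aᴴ h) P`. The complex number whose real part is taken is real,
see `filteredMSE_coe`. -/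
def filteredMSE (Ppred σw2 : ℝ) (σv2 : Fin N → ℝ) (a h : Fin N → ℂ) : ℝ :=
  ((1 - kalmanGain Ppred σw2 σv2 a h * (star a ⬝ᵥ h)) * (Ppred : ℂ)).re

theorem filteredMSE_coe (Ppred σw2 : ℝ) (σv2 : Fin N → ℝ) (a h : Fin N → ℂ) :
    (filteredMSE Ppred σw2 σv2 a h : ℂ)
      = (1 - kalmanGain Ppred σw2 σv2 a h * (star a ⬝ᵥ h)) * (Ppred : ℂ) := by
  have h1 : star (star a ⬝ᵥ h) = star h ⬝ᵥ a := by
    rw [Matrix.star_dotProduct, star_star]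
  have h2 : star (star h ⬝ᵥ a) = star a ⬝ᵥ h := by rw [← h1, star_star]
  have h3 : star (star a ⬝ᵥ ((Matrix.diagonal h * noiseCov σv2 * (Matrix.diagonal h)ᴴ) *ᵥ a))
      = star a ⬝ᵥ ((Matrix.diagonal h * noiseCov σv2 * (Matrix.diagonal h)ᴴ) *ᵥ a) := by
    simp only [noiseCov, Matrix.diagonal_conjTranspose, Matrix.diagonal_mul_diagonal,
      dotProduct, Matrix.mulVec_diagonal, star_sum]
    refine Finset.sum_congr rfl fun i _ => ?_
    simp
    ring
  have h4 : star (innovationVar Ppred σw2 σv2 a h) = innovationVar Ppred σw2 σv2 a h := by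
    unfold innovationVar
    rw [star_add, star_add, h3, star_mul', star_mul', h1, h2]
    simp [mul_comm]
  refine Complex.conj_eq_iff_re.mp ?_
  rw [starRingEnd_apply, star_mul', star_sub, star_mul', h1, kalmanGain, star_div₀, h4, star_mul', h2]
  simp only [star_one, Complex.star_def, Complex.conj_ofReal]
  ring

/-- The equal-power transmit gain vector `a_e`. -/
def equalGain (PT σθ2 : ℝ) (σv2 : Fin N → ℝ) : Fin N → ℂ :=
  fun i => ((√(PT / N) * (1 / √(σθ2 + σv2 i)) : ℝ) : ℂ)

/-- The channel vector with entries `h̃_i / d_i ^ γ`. -/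
def channel (d : Fin N → ℝ) (γ : ℝ) (g : Fin N → ℂ) : Fin N → ℂ :=
  fun i => g i / ((d i ^ γ : ℝ) : ℂ)

/-- `β = (P - ε) / (ε P)` with `P` the prediction MSE. -/
def betaCoef (Ppred ε : ℝ) : ℝ := (Ppred - ε) / (ε * Ppred)

/-- `M = diag(1 / d_i ^ γ)`. -/
def pathLoss (d : Fin N → ℝ) (γ : ℝ) : Matrix (Fin N) (Fin N) ℂ :=
  Matrix.diagonal fun i => ((1 / d i ^ γ : ℝ) : ℂ)

/-- `Q = diag(σ_{v,i}² / (N (σ_θ² + σ_{v,i}²) d_i ^ (2γ)))`. -/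
def matQ (σθ2 : ℝ) (σv2 d : Fin N → ℝ) (γ : ℝ) : Matrix (Fin N) (Fin N) ℂ :=
  Matrix.diagonal fun i => ((σv2 i / (N * (σθ2 + σv2 i) * d i ^ (2 * γ)) : ℝ) : ℂ)

/-- The normalized gain vector `ã_e = a_e / √P_T`. -/
def normGain (PT σθ2 : ℝ) (σv2 : Fin N → ℝ) : Fin N → ℂ :=
  ((1 / √PT : ℝ) : ℂ) • equalGain PT σθ2 σv2

/-- `R = M ã_e ã_eᴴ M - β Q`. -/
def matR (Ppred ε PT σθ2 : ℝ) (σv2 d : Fin N → ℝ) (γ : ℝ) : Matrix (Fin N) (Fin N) ℂ :=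
  pathLoss d γ * vecMulVec (normGain PT σθ2 σv2) (star (normGain PT σθ2 σv2)) * pathLoss d γ
    - (betaCoef Ppred ε : ℂ) • matQ σθ2 σv2 d γ

theorem matR_isHermitian (Ppred ε PT σθ2 : ℝ) (σv2 d : Fin N → ℝ) (γ : ℝ) :
    (matR Ppred ε PT σθ2 σv2 d γ).IsHermitian := by
  have hM : (pathLoss d γ)ᴴ = pathLoss d γ := by
    rw [pathLoss, Matrix.diagonal_conjTranspose]
    congr 1; funext i; simp
  have hQ : (matQ σθ2 σv2 d γ)ᴴ = matQ σθ2 σv2 d γ := by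
    rw [matQ, Matrix.diagonal_conjTranspose]
    congr 1; funext i; simp
  unfold Matrix.IsHermitian matR
  rw [Matrix.conjTranspose_sub, Matrix.conjTranspose_mul, Matrix.conjTranspose_mul,
    Matrix.conjTranspose_vecMulVec, Matrix.conjTranspose_smul, hM, hQ, star_star, Matrix.mul_assoc]
  simp

/-- The eigenvalues `λ_1 ≥ … ≥ λ_N` of `R`, with multiplicity and in nonincreasing order;
`λ_1` has index `0`. -/
def eigR (Ppred ε PT σθ2 : ℝ) (σv2 d : Fin N → ℝ) (γ : ℝ) : Fin N → ℝ :=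
  fun i => (matR_isHermitian Ppred ε PT σθ2 σv2 d γ).eigenvalues₀
    (Fin.cast (Fintype.card_fin N).symm i)

end

end SensorNet

/-!
Put `z` for the vector of fading coefficients. Clearing the positive denominator of the Kalman gain
turns the outage event into `zᴴ R z < β σ_w² / P_T`. The law of `z` is invariant under unitary maps,
so in an orthonormal eigenbasis of `R` the form `zᴴ R z` is a sum `∑ λ_i X_i` with independent
exponential `X_i`. Since `R` is a rank-one matrix minus a positive definite one, its form is
negative on a hyperplane, hence at most one `λ_i` is nonnegative. If it is `λ_1 > 0`, then
`∑ λ_i X_i ≥ t` says that `X_1` exceeds the independent nonnegative variable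
`t / λ_1 + ∑_{i ≠ 1} (-λ_i / λ_1) X_i`, and the probability that an exponential variable of rate `r`
exceeds such a `Y` is `𝔼 exp (-r Y)`, a product of exponential Laplace transforms.
-/

namespace SensorNet

section Exponential

variable {Ω : Type*} [MeasurableSpace Ω] {μ : Measure Ω} {r : ℝ}

lemma complexMGF_id_expMeasure (hr : 0 < r) {z : ℂ} (hz : z.re < r) :
    complexMGF id (expMeasure r) z = r / (r - z) := by
  have hpdf : ∀ x : ℝ, (exponentialPDF r x).toReal • Complex.exp (z * x) =
      (Set.Ici 0).indicator (fun x : ℝ => r * Complex.exp ((z - r) * x)) x := by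
    intro x
    by_cases hx : 0 ≤ x
    · rw [exponentialPDF_of_nonneg hx, Set.indicator_of_mem (Set.mem_Ici.2 hx),
        ENNReal.toReal_ofReal (by positivity), Complex.real_smul, sub_mul, sub_eq_neg_add,
        Complex.exp_add]
      push_cast
      ring
    · simp [exponentialPDF_of_neg (not_le.1 hx), hx]
  have hre : (z - r).re < 0 := by simpa using hz
  calc complexMGF id (expMeasure r) z
      = ∫ x : ℝ, (exponentialPDF r x).toReal • Complex.exp (z * x) :=
        integral_withDensity_eq_integral_toReal_smul
          (measurable_exponentialPDFReal r).ennreal_ofReal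
          (Filter.Eventually.of_forall fun _ => ENNReal.ofReal_lt_top) _
    _ = r * ∫ x : ℝ in Set.Ioi 0, Complex.exp ((z - r) * x) := by
        simp_rw [hpdf]
        rw [integral_indicator measurableSet_Ici, integral_Ici_eq_integral_Ioi,
          integral_const_mul]
    _ = r / (r - z) := by
        rw [integral_exp_mul_complex_Ioi hre, Complex.ofReal_zero, mul_zero, Complex.exp_zero,
          ← neg_sub z, div_neg, neg_div, mul_neg, mul_one_div]

lemma mgf_id_expMeasure (hr : 0 < r) {t : ℝ} (ht : t < r) :
    mgf id (expMeasure r) t = r / (r - t) := by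
  apply Complex.ofReal_injective
  rw [← complexMGF_ofReal, complexMGF_id_expMeasure hr (by simpa using ht)]
  push_cast
  rfl

lemma measureReal_expMeasure_Ici (hr : 0 < r) {s : ℝ} (hs : 0 ≤ s) :
    (expMeasure r).real (Set.Ici s) = Real.exp (-(r * s)) := by
  have := isProbabilityMeasure_expMeasure hr
  have : NullSingletonClass (expMeasure r) :=
    inferInstanceAs (NullSingletonClass (volume.withDensity _))
  rw [← measureReal_congr Ioi_ae_eq_Ici, ← Set.compl_Iic,
    probReal_compl_eq_one_sub measurableSet_Iic, ← cdf_eq_real, cdf_expMeasure_eq hr,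
    if_pos hs, sub_sub_cancel]

lemma ae_nonneg_of_hasLaw_expMeasure (hr : 0 < r) {X : Ω → ℝ} (hX : HasLaw X (expMeasure r) μ) :
    0 ≤ᵐ[μ] X := by
  have := isProbabilityMeasure_expMeasure hr
  have hIci : expMeasure r (Set.Ici 0) = 1 := by
    simpa [Measure.real, ENNReal.toReal_eq_one_iff] using measureReal_expMeasure_Ici hr le_rfl
  exact (hX.ae_iff (p := (0 ≤ ·)) (by fun_prop)).2
    ((mem_ae_iff_prob_eq_one measurableSet_Ici).2 hIci)

lemma measureReal_le_of_hasLaw_expMeasure [IsFiniteMeasure μ] (hr : 0 < r) {X Y : Ω → ℝ}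
    (hX : HasLaw X (expMeasure r) μ) (hY : AEMeasurable Y μ) (hY0 : 0 ≤ᵐ[μ] Y)
    (hYX : IndepFun Y X μ) :
    μ.real {ω | Y ω ≤ X ω} = mgf Y μ (-r) := by
  have := isProbabilityMeasure_expMeasure hr
  have hlaw : HasLaw (fun ω => (Y ω, X ω)) ((μ.map Y).prod (expMeasure r)) μ :=
    ⟨hY.prodMk hX.aemeasurable,
      hX.map_eq ▸ (indepFun_iff_map_prod_eq_prod_map_map hY hX.aemeasurable).1 hYX⟩
  have hS : MeasurableSet {p : ℝ × ℝ | p.1 ≤ p.2} := measurableSet_le measurable_fst measurable_snd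
  have hslice : (fun y => (expMeasure r).real (Prod.mk y ⁻¹' {p : ℝ × ℝ | p.1 ≤ p.2}))
      =ᵐ[μ.map Y] fun y => Real.exp (-r * y) := by
    filter_upwards [(ae_map_iff hY measurableSet_Ici).2 hY0] with y hy
    exact (measureReal_expMeasure_Ici hr hy).trans (by rw [neg_mul])
  calc μ.real {ω | Y ω ≤ X ω}
      = ((μ.map Y).prod (expMeasure r)).real {p | p.1 ≤ p.2} := hlaw.measureReal_eq hS
    _ = ∫ y, (expMeasure r).real (Prod.mk y ⁻¹' {p | p.1 ≤ p.2}) ∂μ.map Y := by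
        rw [Measure.real, Measure.prod_apply hS, ← integral_toReal
          (measurable_measure_prodMk_left hS).aemeasurable (by simp)]
        rfl
    _ = mgf id (μ.map Y) (-r) := integral_congr_ae hslice
    _ = mgf Y μ (-r) := by rw [mgf_id_map hY]

variable {ι : Type*} {X : ι → Ω → ℝ}

lemma measureReal_add_sum_le_of_hasLaw_expMeasure (hr : 0 < r)
    (hX : ∀ i, HasLaw (X i) (expMeasure r) μ) (hindep : iIndepFun X μ) {s : Finset ι} {j : ι}
    (hj : j ∉ s) {a : ι → ℝ} (ha : ∀ i ∈ s, 0 ≤ a i) {t : ℝ} (ht : 0 ≤ t) :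
    μ.real {ω | t + ∑ i ∈ s, a i * X i ω ≤ X j ω} =
      Real.exp (-(r * t)) * ∏ i ∈ s, (1 + a i)⁻¹ := by
  have := hindep.isProbabilityMeasure
  have hXm : ∀ i, AEMeasurable (X i) μ := fun i => (hX i).aemeasurable
  have hnonneg : 0 ≤ᵐ[μ] fun ω => t + ∑ i ∈ s, a i * X i ω := by
    filter_upwards [(Finset.eventually_all s).2
      fun i _ => ae_nonneg_of_hasLaw_expMeasure hr (hX i)] with ω hω
    exact add_nonneg ht (Finset.sum_nonneg fun i hi => mul_nonneg (ha i hi) (hω i hi))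
  have hsum : IndepFun (fun ω => t + ∑ i ∈ s, a i * X i ω) (X j) μ := by
    have hψ : Measurable fun v : ({j} : Finset ι) → ℝ => v ⟨j, Finset.mem_singleton_self j⟩ :=
      measurable_pi_apply _
    have h := (hindep.indepFun_finset₀ s {j} (Finset.disjoint_singleton_right.2 hj) hXm).comp
      (φ := fun v : s → ℝ => t + ∑ i : s, a i * v i)
      (ψ := fun v : ({j} : Finset ι) → ℝ => v ⟨j, Finset.mem_singleton_self j⟩)
      (by fun_prop) hψ
    exact h.congr (Filter.Eventually.of_forall fun ω =>
      congrArg (t + ·) (Finset.sum_coe_sort s fun i => a i * X i ω)) .rfl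
  have hmgf : ∀ i ∈ s, mgf (fun ω => a i * X i ω) μ (-r) = (1 + a i)⁻¹ := by
    intro i hi
    have hlt : a i * -r < r := by nlinarith [mul_nonneg (ha i hi) hr.le]
    rw [mgf_const_mul, ← mgf_id_map (hXm i), (hX i).map_eq, mgf_id_expMeasure hr hlt,
      mul_neg, sub_neg_eq_add, ← one_add_mul, mul_comm, div_mul_cancel_left₀ hr.ne']
  have hscaled : iIndepFun (fun i ω => a i * X i ω) μ :=
    hindep.comp (fun i x => a i * x) fun i => measurable_const_mul (a i)
  rw [measureReal_le_of_hasLaw_expMeasure hr (hX j) (by fun_prop) hnonneg hsum, mgf_const_add,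
    ← Finset.sum_fn, hscaled.mgf_sum₀ (by fun_prop), Finset.prod_congr rfl hmgf, neg_mul]

variable [Fintype ι] [DecidableEq ι]

lemma measureReal_le_sum_mul_of_hasLaw_expMeasure (hr : 0 < r)
    (hX : ∀ i, HasLaw (X i) (expMeasure r) μ) (hindep : iIndepFun X μ) {c : ι → ℝ} {j : ι}
    (hj : 0 < c j) (hc : ∀ i, i ≠ j → c i ≤ 0) {t : ℝ} (ht : 0 ≤ t) :
    μ.real {ω | t ≤ ∑ i, c i * X i ω} =
      c j ^ (Fintype.card ι - 1) / (∏ i ∈ Finset.univ.erase j, (c j - c i)) *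
        Real.exp (-(r * t / c j)) := by
  have hevent : {ω | t ≤ ∑ i, c i * X i ω} =
      {ω | t / c j + ∑ i ∈ Finset.univ.erase j, -(c i / c j) * X i ω ≤ X j ω} := by
    ext ω
    simp only [Set.mem_ofPred_eq]
    rw [← Finset.add_sum_erase _ _ (Finset.mem_univ j), ← sub_le_iff_le_add, ← div_le_iff₀' hj,
      sub_div, Finset.sum_div, sub_eq_add_neg, ← Finset.sum_neg_distrib]
    simp only [neg_mul, mul_div_right_comm]
  have hfactor : ∀ i ∈ Finset.univ.erase j, (1 + -(c i / c j))⁻¹ = c j / (c j - c i) := by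
    intro i _
    rw [← sub_eq_add_neg, one_sub_div hj.ne', inv_div]
  rw [hevent, measureReal_add_sum_le_of_hasLaw_expMeasure hr hX hindep
    (Finset.notMem_erase j _) (fun i hi => neg_nonneg.2
      (div_nonpos_of_nonpos_of_nonneg (hc i (Finset.ne_of_mem_erase hi)) hj.le))
    (div_nonneg ht hj.le), Finset.prod_congr rfl hfactor, Finset.prod_div_distrib,
    Finset.prod_const, Finset.card_erase_of_mem (Finset.mem_univ j), Finset.card_univ,
    mul_div_assoc, mul_comm]

lemma measureReal_sum_mul_lt_of_hasLaw_expMeasure (hr : 0 < r)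
    (hX : ∀ i, HasLaw (X i) (expMeasure r) μ) (hindep : iIndepFun X μ) {c : ι → ℝ} {j : ι}
    (hc : ∀ i, i ≠ j → c i ≤ 0) {t : ℝ} (ht : 0 < t) :
    μ.real {ω | ∑ i, c i * X i ω < t} =
      if 0 < c j then
        1 - c j ^ (Fintype.card ι - 1) / (∏ i ∈ Finset.univ.erase j, (c j - c i)) *
          Real.exp (-(r * t / c j))
      else 1 := by
  have := hindep.isProbabilityMeasure
  have hXm : ∀ i, AEMeasurable (X i) μ := fun i => (hX i).aemeasurable
  split_ifs with hj
  · have hcompl : {ω | ∑ i, c i * X i ω < t} = {ω | t ≤ ∑ i, c i * X i ω}ᶜ := by ext; simp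
    rw [hcompl, probReal_compl_eq_one_sub₀ (nullMeasurableSet_le aemeasurable_const (by fun_prop)),
      measureReal_le_sum_mul_of_hasLaw_expMeasure hr hX hindep hj hc ht.le]
  · have hc' : ∀ i, c i ≤ 0 := fun i => by
      by_cases hi : i = j
      exacts [hi ▸ not_lt.1 hj, hc i hi]
    have hsure : ∀ᵐ ω ∂μ, ∑ i, c i * X i ω < t := by
      filter_upwards [ae_all_iff.2 fun i => ae_nonneg_of_hasLaw_expMeasure hr (hX i)] with ω hω
      exact (Finset.sum_nonpos fun i _ => mul_nonpos_of_nonpos_of_nonneg (hc' i) (hω i)).trans_lt ht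
    rw [measureReal_congr (Filter.eventuallyEq_univ.2 hsure), probReal_univ]

end Exponential


section ComplexNormal

variable {v : ℝ≥0}

lemma measurable_complex_mk : Measurable fun p : ℝ × ℝ => (⟨p.1, p.2⟩ : ℂ) :=
  Complex.measurableEquivRealProd.symm.measurable

instance : IsProbabilityMeasure (complexNormal v) :=
  Measure.isProbabilityMeasure_map measurable_complex_mk.aemeasurable

-- Stated for the square of the transform, so that no branch of the complex square root appears.
lemma complexMGF_sq_gaussianReal_sq {z : ℂ} (hz : 2 * v * z.re < 1) :
    complexMGF (· ^ 2) (gaussianReal 0 v) z ^ 2 = (1 - 2 * v * z)⁻¹ := by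
  rcases eq_or_ne v 0 with rfl | hv
  · simp [complexMGF]
  have hvc : (v : ℂ) ≠ 0 := by exact_mod_cast hv
  have hre : 0 < ((2 * v : ℝ)⁻¹ - z : ℂ).re := by
    rw [Complex.sub_re, Complex.ofReal_re, sub_pos, ← mul_one (2 * (v : ℝ))⁻¹,
      lt_inv_mul_iff₀ (by positivity)]
    exact hz
  have hdensity : ∀ x : ℝ, gaussianPDFReal 0 v x • Complex.exp (z * (x ^ 2 : ℝ)) =
      (√(2 * Real.pi * v))⁻¹ * Complex.exp (-((2 * v : ℝ)⁻¹ - z) * x ^ 2) := by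
    intro x
    rw [gaussianPDFReal, Complex.real_smul, Complex.ofReal_mul, mul_assoc, Complex.ofReal_exp,
      ← Complex.exp_add]
    push_cast
    congr 3
    ring
  have hsqrt : ((√(2 * Real.pi * v) : ℝ) : ℂ) ^ 2 = 2 * Real.pi * v := by
    rw [← Complex.ofReal_pow, Real.sq_sqrt (by positivity)]
    push_cast
    rfl
  rw [complexMGF, integral_gaussianReal_eq_integral_smul hv]
  simp_rw [hdensity]
  rw [integral_const_mul, mul_pow, integral_gaussian_sq_complex hre, Complex.ofReal_inv, inv_pow,
    hsqrt]
  have hfactor : ((2 * v : ℝ)⁻¹ : ℝ) - z = (1 - 2 * v * z) / (2 * v) := by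
    push_cast
    field_simp
  rw [hfactor]
  field_simp

lemma complexMGF_normSq_complexNormal {z : ℂ} (hz : v * z.re < 1) :
    complexMGF Complex.normSq (complexNormal v) z = (1 - v * z)⁻¹ := by
  have hsplit : ∀ p : ℝ × ℝ, Complex.exp (z * Complex.normSq ⟨p.1, p.2⟩) =
      Complex.exp (z * (p.1 ^ 2 : ℝ)) * Complex.exp (z * (p.2 ^ 2 : ℝ)) := by
    intro p
    rw [← Complex.exp_add, ← mul_add, ← Complex.ofReal_add, Complex.normSq_apply, sq, sq]
  have hhalf : 2 * ((v / 2 : ℝ≥0) : ℝ) = v := by push_cast; ring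
  calc complexMGF Complex.normSq (complexNormal v) z
      = complexMGF (· ^ 2) (gaussianReal 0 (v / 2)) z ^ 2 := by
        rw [complexMGF, complexNormal, integral_map measurable_complex_mk.aemeasurable
          (by fun_prop)]
        simp_rw [hsplit]
        rw [integral_prod_mul (fun x : ℝ => Complex.exp (z * (x ^ 2 : ℝ)))
          (fun x : ℝ => Complex.exp (z * (x ^ 2 : ℝ))), sq]
        rfl
    _ = (1 - v * z)⁻¹ := by
        rw [complexMGF_sq_gaussianReal_sq (by rwa [hhalf]), ← hhalf]
        push_cast
        rfl

lemma hasLaw_normSq_complexNormal (hv : v ≠ 0) :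
    HasLaw Complex.normSq (expMeasure (v⁻¹ : ℝ≥0)) (complexNormal v) := by
  have hr : (0 : ℝ) < (v⁻¹ : ℝ≥0) := by positivity
  have hvc : (v : ℂ) ≠ 0 := by exact_mod_cast hv
  have := isProbabilityMeasure_expMeasure hr
  have hm : AEMeasurable Complex.normSq (complexNormal v) := by fun_prop
  refine ⟨hm, Measure.ext_of_charFun (funext fun t => ?_)⟩
  rw [← complexMGF_mul_I hm, ← complexMGF_id_mul_I, complexMGF_normSq_complexNormal (by simp),
    complexMGF_id_expMeasure hr (by simpa using hr)]
  push_cast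
  rw [inv_eq_one_div, ← mul_div_mul_left _ _ (inv_ne_zero hvc), mul_sub, inv_mul_cancel_left₀ hvc,
    mul_one]

lemma charFun_complexNormal (t : ℂ) :
    charFun (complexNormal v) t = Complex.exp (-(v * ‖t‖ ^ 2 / 4)) := by
  have hsplit : ∀ p : ℝ × ℝ, Complex.exp ((inner ℝ (⟨p.1, p.2⟩ : ℂ) t : ℝ) * Complex.I) =
      Complex.exp (t.re * p.1 * Complex.I) * Complex.exp (t.im * p.2 * Complex.I) := by
    intro p
    rw [← Complex.exp_add, ← add_mul]
    congr 2
    simp [Complex.inner]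
  rw [charFun_apply, complexNormal, integral_map measurable_complex_mk.aemeasurable (by fun_prop)]
  simp_rw [hsplit]
  rw [integral_prod_mul (fun x : ℝ => Complex.exp (t.re * x * Complex.I))
    (fun x : ℝ => Complex.exp (t.im * x * Complex.I)), ← charFun_apply_real, ← charFun_apply_real,
    charFun_gaussianReal, charFun_gaussianReal, ← Complex.exp_add, ← Complex.ofReal_pow ‖t‖,
    ← Complex.normSq_eq_norm_sq, Complex.normSq_apply]
  congr 1
  push_cast
  ring

variable {ι κ : Type*} [Fintype ι] [Fintype κ]

lemma eq_pi_complexNormal_iff_charFun {ν : Measure (ι → ℂ)} [IsFiniteMeasure ν] :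
    ν = Measure.pi (fun _ => complexNormal v) ↔
      ∀ t : EuclideanSpace ℂ ι,
        charFun (ν.map (WithLp.toLp 2)) t = Complex.exp (-(v * ‖t‖ ^ 2 / 4)) := by
  have hprod : ∀ t : EuclideanSpace ℂ ι,
      ∏ i, charFun (complexNormal v) (t i) = Complex.exp (-(v * ‖t‖ ^ 2 / 4)) := by
    intro t
    simp_rw [charFun_complexNormal]
    rw [← Complex.exp_sum, Finset.sum_neg_distrib, ← Finset.sum_div, ← Finset.mul_sum,
      ← Complex.ofReal_pow ‖t‖, EuclideanSpace.norm_sq_eq]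
    push_cast
    rfl
  simp_rw [← hprod]
  exact charFun_eq_pi_iff.symm

lemma charFun_map_linearIsometryEquiv {E F : Type*} [NormedAddCommGroup E] [InnerProductSpace ℝ E]
    [MeasurableSpace E] [BorelSpace E] [NormedAddCommGroup F] [InnerProductSpace ℝ F]
    [MeasurableSpace F] [BorelSpace F] (ν : Measure E) (U : E ≃ₗᵢ[ℝ] F) (t : F) :
    charFun (ν.map U) t = charFun ν (U.symm t) := by
  rw [charFun_apply, integral_map U.continuous.aemeasurable (by fun_prop), charFun_apply]
  refine integral_congr_ae (Filter.Eventually.of_forall fun x => ?_)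
  simp only [U.inner_map_eq_flip x t]

lemma map_linearIsometryEquiv_pi_complexNormal (U : EuclideanSpace ℂ κ ≃ₗᵢ[ℂ] EuclideanSpace ℂ ι) :
    (Measure.pi fun _ : κ => complexNormal v).map (fun z => (U (WithLp.toLp 2 z)).ofLp) =
      Measure.pi fun _ : ι => complexNormal v := by
  have hm : Measurable fun z : κ → ℂ => (U (WithLp.toLp 2 z)).ofLp := by fun_prop
  have := Measure.isProbabilityMeasure_map (μ := Measure.pi fun _ : κ => complexNormal v)
    hm.aemeasurable
  let V : EuclideanSpace ℂ κ ≃ₗᵢ[ℝ] EuclideanSpace ℂ ι :=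
    ⟨U.toLinearEquiv.restrictScalars ℝ, U.norm_map⟩
  refine eq_pi_complexNormal_iff_charFun.2 fun t => ?_
  have hcomp : ((Measure.pi fun _ : κ => complexNormal v).map
      fun z => (U (WithLp.toLp 2 z)).ofLp).map (WithLp.toLp 2) =
      ((Measure.pi fun _ : κ => complexNormal v).map (WithLp.toLp 2)).map V := by
    rw [Measure.map_map (by fun_prop) hm, Measure.map_map (by fun_prop) (by fun_prop)]
    rfl
  rw [hcomp, charFun_map_linearIsometryEquiv, eq_pi_complexNormal_iff_charFun.1 rfl,
    V.symm.norm_map]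

variable {Ω : Type*} [MeasurableSpace Ω] {μ : Measure Ω} {g : κ → Ω → ℂ}

lemma hasLaw_linearIsometryEquiv_complexNormal (hg : ∀ j, HasLaw (g j) (complexNormal v) μ)
    (hindep : iIndepFun g μ) (U : EuclideanSpace ℂ κ ≃ₗᵢ[ℂ] EuclideanSpace ℂ ι) :
    HasLaw (fun ω i => U (WithLp.toLp 2 fun j => g j ω) i)
      (Measure.pi fun _ => complexNormal v) μ := by
  have hU : HasLaw (fun z : κ → ℂ => (U (WithLp.toLp 2 z)).ofLp)
      (Measure.pi fun _ => complexNormal v) (Measure.pi fun _ => complexNormal v) :=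
    ⟨by fun_prop, map_linearIsometryEquiv_pi_complexNormal U⟩
  exact hU.comp (hindep.hasLaw_pi hg)

lemma iIndepFun_and_hasLaw_of_hasLaw_pi {E : ι → Type*} [∀ i, MeasurableSpace (E i)]
    {ν : ∀ i, Measure (E i)} [∀ i, IsProbabilityMeasure (ν i)] {X : ∀ i, Ω → E i}
    (hX : HasLaw (fun ω i => X i ω) (Measure.pi ν) μ) :
    iIndepFun X μ ∧ ∀ i, HasLaw (X i) (ν i) μ := by
  have := hX.isProbabilityMeasure
  have hi : ∀ i, HasLaw (X i) (ν i) μ := fun i => (measurePreserving_eval ν i).hasLaw.comp hX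
  exact ⟨(iIndepFun_iff_hasLaw_pi_pi hi).2 hX, hi⟩

end ComplexNormal


section HermitianForm

open scoped ComplexOrder

variable {n : Type*} [Fintype n]

lemma star_dotProduct_vecMulVec_star_mulVec (u z : n → ℂ) :
    star z ⬝ᵥ vecMulVec u (star u) *ᵥ z = Complex.normSq (star u ⬝ᵥ z) := by
  rw [vecMulVec_mulVec, Complex.normSq_eq_conj_mul_self, dotProduct_smul, starRingEnd_apply,
    ← star_dotProduct, op_smul_eq_mul]

variable [DecidableEq n]

lemma star_dotProduct_diagonal_mulVec (q : n → ℝ) (z : n → ℂ) :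
    star z ⬝ᵥ diagonal (fun i => (q i : ℂ)) *ᵥ z =
      ((∑ i, q i * Complex.normSq (z i) : ℝ) : ℂ) := by
  simp only [dotProduct, mulVec_diagonal, Complex.ofReal_sum, Complex.ofReal_mul,
    Complex.normSq_eq_conj_mul_self, Pi.star_apply, Complex.star_def, mul_left_comm]

variable {A B : Matrix n n ℂ}

lemma star_dotProduct_mulVec_eq_sum_eigenvalues (hA : A.IsHermitian) (z : n → ℂ) :
    star z ⬝ᵥ A *ᵥ z = ((∑ i, hA.eigenvalues i *
      Complex.normSq (hA.eigenvectorBasis.repr (WithLp.toLp 2 z) i) : ℝ) : ℂ) := by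
  let b := hA.eigenvectorBasis
  have hinner : ∀ x y : EuclideanSpace ℂ n, inner ℂ x y = star x.ofLp ⬝ᵥ y.ofLp := fun x y => by
    rw [EuclideanSpace.inner_eq_star_dotProduct, dotProduct_comm]
  have hb : ∀ i, inner ℂ (b i) (WithLp.toLp 2 (A *ᵥ z)) =
      hA.eigenvalues i * inner ℂ (b i) (WithLp.toLp 2 z) := by
    intro i
    have hadj : star (b i).ofLp ᵥ* A = star (A *ᵥ (b i).ofLp) := by rw [star_mulVec, hA.eq]
    rw [hinner, hinner, dotProduct_mulVec, hadj, hA.mulVec_eigenvectorBasis, star_smul,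
      smul_dotProduct, star_trivial, Complex.real_smul]
  calc star z ⬝ᵥ A *ᵥ z
      = inner ℂ (WithLp.toLp 2 z) (WithLp.toLp 2 (A *ᵥ z) : EuclideanSpace ℂ n) := by rw [hinner]
    _ = ∑ i, (hA.eigenvalues i * Complex.normSq (b.repr (WithLp.toLp 2 z) i) : ℂ) := by
        rw [← b.sum_inner_mul_inner]
        refine Finset.sum_congr rfl fun i _ => ?_
        rw [hb, b.repr_apply_apply, Complex.normSq_eq_conj_mul_self, inner_conj_symm]
        ring
    _ = _ := by push_cast; rfl

lemma eigenvalues_neg_or_neg_of_neg_on_ker (hA : A.IsHermitian) (f : (n → ℂ) →ₗ[ℂ] ℂ)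
    (hf : ∀ z, z ≠ 0 → f z = 0 → star z ⬝ᵥ A *ᵥ z < 0) {i j : n} (hij : i ≠ j) :
    hA.eigenvalues i < 0 ∨ hA.eigenvalues j < 0 := by
  let b := hA.eigenvectorBasis
  -- The plane spanned by two eigenvectors meets the hyperplane `ker f` in a nonzero vector.
  have hker : ∃ x y : ℂ, (x ≠ 0 ∨ y ≠ 0) ∧ f (x • (b i).ofLp + y • (b j).ofLp) = 0 := by
    by_cases hj : f (b j).ofLp = 0
    · exact ⟨0, 1, by simp [hj]⟩
    · exact ⟨f (b j).ofLp, -f (b i).ofLp, Or.inl hj, by simp [mul_comm]⟩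
  obtain ⟨x, y, hxy, hfz⟩ := hker
  set z := x • b i + y • b j with hz
  have hcoord : b.repr z = EuclideanSpace.single i x + EuclideanSpace.single j y := by
    ext k
    simp [hz]
  have hz0 : z.ofLp ≠ 0 := by
    intro h
    have : b.repr z = 0 := by rw [(WithLp.ofLp_eq_zero 2).1 h, map_zero]
    rw [hcoord] at this
    have hx : x = 0 := by simpa [hij] using congrFun (congrArg WithLp.ofLp this) i
    have hy : y = 0 := by simpa [hij.symm] using congrFun (congrArg WithLp.ofLp this) j
    exact hxy.elim (· hx) (· hy)
  have hneg := hf z.ofLp hz0 hfz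
  rw [star_dotProduct_mulVec_eq_sum_eigenvalues hA, ← Complex.ofReal_zero, Complex.real_lt_real]
    at hneg
  by_contra! hnonneg
  refine (Finset.sum_nonneg fun k _ => ?_).not_gt hneg
  by_cases hk : k = i ∨ k = j
  · exact mul_nonneg (by rcases hk with rfl | rfl; exacts [hnonneg.1, hnonneg.2])
      (Complex.normSq_nonneg _)
  · push Not at hk
    change 0 ≤ _ * Complex.normSq (b.repr z k)
    simp [hcoord, hk.1, hk.2]

lemma eigenvalues_neg_or_neg_of_vecMulVec_sub_posDef (hA : A.IsHermitian) {u : n → ℂ}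
    (hB : B.PosDef) (hAB : A = vecMulVec u (star u) - B) {i j : n} (hij : i ≠ j) :
    hA.eigenvalues i < 0 ∨ hA.eigenvalues j < 0 := by
  refine eigenvalues_neg_or_neg_of_neg_on_ker hA (dotProductBilin ℂ ℂ (star u)) ?_ hij
  intro z hz hu
  rw [dotProductBilin_apply_apply] at hu
  rw [hAB, sub_mulVec, dotProduct_sub, star_dotProduct_vecMulVec_star_mulVec, hu, map_zero,
    Complex.ofReal_zero, zero_sub, neg_lt_zero]
  exact hB.dotProduct_mulVec_pos hz

variable {Ω : Type*} [MeasurableSpace Ω] {μ : Measure Ω} {v : ℝ≥0} {g : n → Ω → ℂ}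

lemma exists_expMeasure_star_dotProduct_mulVec_eq_sum (hA : A.IsHermitian) (hv : v ≠ 0)
    (hg : ∀ j, HasLaw (g j) (complexNormal v) μ) (hindep : iIndepFun g μ) :
    ∃ X : n → Ω → ℝ, (∀ i, HasLaw (X i) (expMeasure (v⁻¹ : ℝ≥0)) μ) ∧ iIndepFun X μ ∧
      ∀ ω, star (fun j => g j ω) ⬝ᵥ A *ᵥ (fun j => g j ω) =
        ((∑ i, hA.eigenvalues i * X i ω : ℝ) : ℂ) := by
  let U := hA.eigenvectorBasis.repr
  obtain ⟨hUindep, hU⟩ := iIndepFun_and_hasLaw_of_hasLaw_pi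
    (hasLaw_linearIsometryEquiv_complexNormal hg hindep U)
  exact ⟨fun i ω => Complex.normSq (U (WithLp.toLp 2 fun j => g j ω) i),
    fun i => (hasLaw_normSq_complexNormal hv).comp (hU i),
    hUindep.comp (fun _ => Complex.normSq) fun _ => by fun_prop,
    fun ω => star_dotProduct_mulVec_eq_sum_eigenvalues hA _⟩

end HermitianForm


section SensorNetwork

open scoped ComplexOrder

variable {N : ℕ} {Ppred σw2 ε PT σθ2 γ : ℝ} {σv2 d : Fin N → ℝ}

lemma innovationVar_eq_ofReal (a h : Fin N → ℂ) :
    innovationVar Ppred σw2 σv2 a h =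
      ((∑ i, σv2 i * Complex.normSq (a i) * Complex.normSq (h i) +
        Ppred * Complex.normSq (star a ⬝ᵥ h) + σw2 : ℝ) : ℂ) := by
  have hnoise : star a ⬝ᵥ (diagonal h * noiseCov σv2 * (diagonal h)ᴴ) *ᵥ a =
      ((∑ i, σv2 i * Complex.normSq (a i) * Complex.normSq (h i) : ℝ) : ℂ) := by
    simp only [noiseCov, diagonal_conjTranspose, diagonal_mul_diagonal, dotProduct,
      mulVec_diagonal, Complex.ofReal_sum, Complex.ofReal_mul, Complex.normSq_eq_conj_mul_self,
      Pi.star_apply, Complex.star_def]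
    exact Finset.sum_congr rfl fun i _ => by ring
  rw [innovationVar, hnoise, star_dotProduct h a, Complex.star_def, Complex.mul_conj]
  push_cast
  rfl

lemma filteredMSE_eq_div (hσw : 0 < σw2) (hσv : ∀ i, 0 ≤ σv2 i) (hP : 0 ≤ Ppred)
    (a h : Fin N → ℂ) :
    filteredMSE Ppred σw2 σv2 a h =
      (∑ i, σv2 i * Complex.normSq (a i) * Complex.normSq (h i) + σw2) * Ppred /
        (∑ i, σv2 i * Complex.normSq (a i) * Complex.normSq (h i) +
          Ppred * Complex.normSq (star a ⬝ᵥ h) + σw2) := by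
  set S := ∑ i, σv2 i * Complex.normSq (a i) * Complex.normSq (h i) with hS
  set G := Complex.normSq (star a ⬝ᵥ h) with hG
  have hS0 : 0 ≤ S := Finset.sum_nonneg fun i _ =>
    mul_nonneg (mul_nonneg (hσv i) (Complex.normSq_nonneg _)) (Complex.normSq_nonneg _)
  have hG0 : 0 ≤ G := Complex.normSq_nonneg _
  have hgain : filteredMSE Ppred σw2 σv2 a h =
      (1 - Ppred * G / (S + Ppred * G + σw2)) * Ppred := by
    apply Complex.ofReal_injective
    rw [filteredMSE_coe, kalmanGain, innovationVar_eq_ofReal, ← hS, ← hG, star_dotProduct h a,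
      div_mul_eq_mul_div, mul_assoc, Complex.star_def, ← Complex.normSq_eq_conj_mul_self, ← hG]
    push_cast
    rfl
  have hD : S + Ppred * G + σw2 ≠ 0 := by positivity
  rw [hgain, one_sub_div hD, div_mul_eq_mul_div]
  ring

lemma betaCoef_pos (hε : 0 < ε) (hεP : ε < Ppred) : 0 < betaCoef Ppred ε :=
  div_pos (sub_pos.2 hεP) (mul_pos hε (hε.trans hεP))

lemma lt_filteredMSE_iff (hσw : 0 < σw2) (hσv : ∀ i, 0 ≤ σv2 i) (hε : 0 < ε) (hεP : ε < Ppred)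
    (a h : Fin N → ℂ) :
    ε < filteredMSE Ppred σw2 σv2 a h ↔
      Complex.normSq (star a ⬝ᵥ h) -
          betaCoef Ppred ε * ∑ i, σv2 i * Complex.normSq (a i) * Complex.normSq (h i) <
        betaCoef Ppred ε * σw2 := by
  have hP : 0 < Ppred := hε.trans hεP
  rw [filteredMSE_eq_div hσw hσv hP.le]
  set S := ∑ i, σv2 i * Complex.normSq (a i) * Complex.normSq (h i)
  set G := Complex.normSq (star a ⬝ᵥ h)
  have hS0 : 0 ≤ S := Finset.sum_nonneg fun i _ =>
    mul_nonneg (mul_nonneg (hσv i) (Complex.normSq_nonneg _)) (Complex.normSq_nonneg _)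
  have hG0 : 0 ≤ G := Complex.normSq_nonneg _
  have hD : 0 < S + Ppred * G + σw2 := by positivity
  calc ε < (S + σw2) * Ppred / (S + Ppred * G + σw2)
      ↔ ε * Ppred * G < (Ppred - ε) * (σw2 + S) := by
        rw [lt_div_iff₀ hD]
        constructor <;> intro hlt <;> linarith
    _ ↔ G < betaCoef Ppred ε * (σw2 + S) := by
        rw [betaCoef, div_mul_eq_mul_div, lt_div_iff₀' (mul_pos hε hP)]
    _ ↔ G - betaCoef Ppred ε * S < betaCoef Ppred ε * σw2 := by rw [mul_add, sub_lt_iff_lt_add]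

lemma pathLoss_isHermitian : (pathLoss d γ).IsHermitian :=
  isHermitian_diagonal_of_self_adjoint _ (funext fun _ => Complex.conj_ofReal _)

lemma star_pathLoss_mulVec (x : Fin N → ℂ) :
    star (pathLoss d γ *ᵥ x) = star x ᵥ* pathLoss d γ := by
  rw [star_mulVec, pathLoss_isHermitian.eq]

lemma channel_eq_pathLoss_mulVec (z : Fin N → ℂ) : channel d γ z = pathLoss d γ *ᵥ z := by
  ext i
  simp [channel, pathLoss, mulVec_diagonal, div_eq_inv_mul]

lemma equalGain_eq_smul_normGain (hPT : 0 < PT) :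
    equalGain PT σθ2 σv2 = (√PT : ℂ) • normGain PT σθ2 σv2 := by
  have hs : (√PT : ℂ) ≠ 0 := Complex.ofReal_ne_zero.2 (Real.sqrt_pos.2 hPT).ne'
  rw [normGain, Complex.ofReal_div, Complex.ofReal_one, one_div, smul_inv_smul₀ hs]

lemma matR_eq_vecMulVec_sub :
    matR Ppred ε PT σθ2 σv2 d γ =
      vecMulVec (pathLoss d γ *ᵥ normGain PT σθ2 σv2) (star (pathLoss d γ *ᵥ normGain PT σθ2 σv2)) -
        (betaCoef Ppred ε : ℂ) • matQ σθ2 σv2 d γ := by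
  rw [matR, mul_vecMulVec, vecMulVec_mul, star_pathLoss_mulVec]

lemma normSq_star_equalGain_dotProduct_channel (hPT : 0 < PT) (z : Fin N → ℂ) :
    Complex.normSq (star (equalGain PT σθ2 σv2) ⬝ᵥ channel d γ z) =
      PT * Complex.normSq (star (pathLoss d γ *ᵥ normGain PT σθ2 σv2) ⬝ᵥ z) := by
  rw [equalGain_eq_smul_normGain hPT, channel_eq_pathLoss_mulVec, star_pathLoss_mulVec,
    ← dotProduct_mulVec, star_smul, smul_dotProduct, smul_eq_mul, Complex.normSq_mul,
    Complex.star_def, Complex.normSq_conj, Complex.normSq_ofReal, Real.mul_self_sqrt hPT.le]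

lemma sum_normSq_equalGain_mul_normSq_channel (hPT : 0 ≤ PT) (hσθ : 0 ≤ σθ2)
    (hσv : ∀ i, 0 < σv2 i) (hd : ∀ i, 0 < d i) (z : Fin N → ℂ) :
    ((∑ i, σv2 i * Complex.normSq (equalGain PT σθ2 σv2 i) *
        Complex.normSq (channel d γ z i) : ℝ) : ℂ) =
      PT * (star z ⬝ᵥ matQ σθ2 σv2 d γ *ᵥ z) := by
  rw [matQ, star_dotProduct_diagonal_mulVec, ← Complex.ofReal_mul, Finset.mul_sum]
  refine congrArg _ (Finset.sum_congr rfl fun i _ => ?_)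
  have hs : 0 < σθ2 + σv2 i := add_pos_of_nonneg_of_pos hσθ (hσv i)
  have hpow : d i ^ (2 * γ) = d i ^ γ * d i ^ γ := by rw [two_mul, Real.rpow_add (hd i)]
  have hgain : Complex.normSq (equalGain PT σθ2 σv2 i) = PT / N * (1 / (σθ2 + σv2 i)) := by
    rw [equalGain, Complex.normSq_ofReal, mul_mul_mul_comm, Real.mul_self_sqrt (by positivity),
      div_mul_div_comm, Real.mul_self_sqrt hs.le, one_mul]
  rw [hgain, channel, map_div₀, Complex.normSq_ofReal, hpow]
  simp only [div_eq_mul_inv, mul_inv]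
  ring

lemma mul_star_dotProduct_matR_mulVec (hPT : 0 < PT) (hσθ : 0 ≤ σθ2) (hσv : ∀ i, 0 < σv2 i)
    (hd : ∀ i, 0 < d i) (z : Fin N → ℂ) :
    PT * (star z ⬝ᵥ matR Ppred ε PT σθ2 σv2 d γ *ᵥ z) =
      ((Complex.normSq (star (equalGain PT σθ2 σv2) ⬝ᵥ channel d γ z) -
        betaCoef Ppred ε * ∑ i, σv2 i * Complex.normSq (equalGain PT σθ2 σv2 i) *
          Complex.normSq (channel d γ z i) : ℝ) : ℂ) := by
  rw [matR_eq_vecMulVec_sub, sub_mulVec, dotProduct_sub, star_dotProduct_vecMulVec_star_mulVec,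
    smul_mulVec, dotProduct_smul, smul_eq_mul, Complex.ofReal_sub, Complex.ofReal_mul,
    sum_normSq_equalGain_mul_normSq_channel hPT.le hσθ hσv hd,
    normSq_star_equalGain_dotProduct_channel hPT, Complex.ofReal_mul]
  ring

lemma lt_filteredMSE_equalGain_channel_iff (hσθ : 0 ≤ σθ2) (hσw : 0 < σw2) (hPT : 0 < PT)
    (hσv : ∀ i, 0 < σv2 i) (hd : ∀ i, 0 < d i) (hε : 0 < ε) (hεP : ε < Ppred) (z : Fin N → ℂ) :
    ε < filteredMSE Ppred σw2 σv2 (equalGain PT σθ2 σv2) (channel d γ z) ↔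
      (star z ⬝ᵥ matR Ppred ε PT σθ2 σv2 d γ *ᵥ z).re < betaCoef Ppred ε * σw2 / PT := by
  have hre := congrArg Complex.re (mul_star_dotProduct_matR_mulVec (Ppred := Ppred) (ε := ε)
    (γ := γ) hPT hσθ hσv hd z)
  rw [Complex.re_ofReal_mul, Complex.ofReal_re] at hre
  rw [lt_filteredMSE_iff hσw (fun i => (hσv i).le) hε hεP, ← hre, lt_div_iff₀' hPT]

lemma matQ_posDef (hσθ : 0 ≤ σθ2) (hσv : ∀ i, 0 < σv2 i) (hd : ∀ i, 0 < d i) :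
    (matQ σθ2 σv2 d γ).PosDef := by
  refine PosDef.diagonal fun i => Complex.zero_lt_real.2 ?_
  have hN : (0 : ℝ) < N := Nat.cast_pos.2 (Fin.pos i)
  have hs : 0 < σθ2 + σv2 i := add_pos_of_nonneg_of_pos hσθ (hσv i)
  exact div_pos (hσv i) (mul_pos (mul_pos hN hs) (Real.rpow_pos_of_pos (hd i) _))

lemma exists_perm_eigR_eq_eigenvalues (Ppred ε PT σθ2 : ℝ) (σv2 d : Fin N → ℝ) (γ : ℝ) :
    ∃ σ : Equiv.Perm (Fin N), ∀ i, eigR Ppred ε PT σθ2 σv2 d γ i =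
      (matR_isHermitian Ppred ε PT σθ2 σv2 d γ).eigenvalues (σ i) :=
  ⟨(finCongr (Fintype.card_fin N).symm).trans
    (Fintype.equivOfCardEq (Fintype.card_fin (Fintype.card (Fin N)))),
    fun i => by simp [IsHermitian.eigenvalues, eigR]⟩

lemma eigR_antitone : Antitone (eigR Ppred ε PT σθ2 σv2 d γ) := fun _ _ hij =>
  (matR_isHermitian Ppred ε PT σθ2 σv2 d γ).eigenvalues₀_antitone hij

lemma eigR_neg [NeZero N] (hσθ : 0 ≤ σθ2) (hσv : ∀ i, 0 < σv2 i) (hd : ∀ i, 0 < d i)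
    (hε : 0 < ε) (hεP : ε < Ppred) {i : Fin N} (hi : i ≠ 0) :
    eigR Ppred ε PT σθ2 σv2 d γ i < 0 := by
  obtain ⟨σ, hσ⟩ := exists_perm_eigR_eq_eigenvalues Ppred ε PT σθ2 σv2 d γ
  have hβQ : ((betaCoef Ppred ε : ℂ) • matQ σθ2 σv2 d γ).PosDef :=
    (matQ_posDef hσθ hσv hd).smul (Complex.zero_lt_real.2 (betaCoef_pos hε hεP))
  rcases eigenvalues_neg_or_neg_of_vecMulVec_sub_posDef
    (matR_isHermitian Ppred ε PT σθ2 σv2 d γ) hβQ matR_eq_vecMulVec_sub (σ.injective.ne hi)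
    with hneg | hneg
  · rwa [hσ]
  · rw [← hσ] at hneg
    exact (eigR_antitone (Fin.zero_le i)).trans_lt hneg

lemma exists_expMeasure_star_dotProduct_matR_mulVec_eq_sum (Ppred ε PT σθ2 : ℝ)
    (σv2 d : Fin N → ℝ) (γ : ℝ) {Ω : Type*} [MeasurableSpace Ω] {μ : Measure Ω} {v : ℝ≥0}
    {g : Fin N → Ω → ℂ} (hv : v ≠ 0)
    (hg : ∀ i, HasLaw (g i) (complexNormal v) μ) (hindep : iIndepFun g μ) :
    ∃ X : Fin N → Ω → ℝ, (∀ i, HasLaw (X i) (expMeasure (v⁻¹ : ℝ≥0)) μ) ∧ iIndepFun X μ ∧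
      ∀ ω, star (fun i => g i ω) ⬝ᵥ matR Ppred ε PT σθ2 σv2 d γ *ᵥ (fun i => g i ω) =
        ((∑ i, eigR Ppred ε PT σθ2 σv2 d γ i * X i ω : ℝ) : ℂ) := by
  obtain ⟨X, hX, hXindep, hsum⟩ := exists_expMeasure_star_dotProduct_mulVec_eq_sum
    (matR_isHermitian Ppred ε PT σθ2 σv2 d γ) hv hg hindep
  obtain ⟨σ, hσ⟩ := exists_perm_eigR_eq_eigenvalues Ppred ε PT σθ2 σv2 d γ
  refine ⟨X ∘ σ, fun i => hX (σ i), hXindep.precomp (g := σ) σ.injective, fun ω => ?_⟩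
  rw [hsum, ← Equiv.sum_comp σ]
  simp only [hσ, Function.comp_apply]

end SensorNetwork

end SensorNet

theorem mainTheorem6 {Ω : Type*} [MeasurableSpace Ω] (μ : Measure Ω) [IsProbabilityMeasure μ]
    (N : ℕ) [NeZero N]
    (σθ2 σw2 PT Ppred ε γ : ℝ) (σv2 d : Fin N → ℝ)
    (hσθ : 0 ≤ σθ2) (hσw : 0 < σw2) (hPT : 0 < PT)
    (hσv : ∀ i, 0 < σv2 i) (hd : ∀ i, 0 < d i)
    (hε : 0 < ε) (hεP : ε < Ppred)
    (g : Fin N → Ω → ℂ)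
    (hlaw : ∀ i, HasLaw (g i) (SensorNet.complexNormal 1) μ)
    (hindep : iIndepFun g μ) :
    (∀ i : Fin N, i ≠ 0 → SensorNet.eigR Ppred ε PT σθ2 σv2 d γ i < 0) ∧
    μ.real {ω | ε < SensorNet.filteredMSE Ppred σw2 σv2 (SensorNet.equalGain PT σθ2 σv2)
        (SensorNet.channel d γ fun i => g i ω)} =
      if 0 < SensorNet.eigR Ppred ε PT σθ2 σv2 d γ 0 then
        1 - SensorNet.eigR Ppred ε PT σθ2 σv2 d γ 0 ^ (N - 1) /
            (∏ l ∈ Finset.univ.erase (0 : Fin N),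
              (SensorNet.eigR Ppred ε PT σθ2 σv2 d γ 0 - SensorNet.eigR Ppred ε PT σθ2 σv2 d γ l)) *
          Real.exp (-((Ppred - ε) * σw2 /
            (ε * Ppred * PT * SensorNet.eigR Ppred ε PT σθ2 σv2 d γ 0)))
      else 1 := by
  have hneg : ∀ i : Fin N, i ≠ 0 → SensorNet.eigR Ppred ε PT σθ2 σv2 d γ i < 0 :=
    fun i hi => SensorNet.eigR_neg hσθ hσv hd hε hεP hi
  refine ⟨hneg, ?_⟩
  obtain ⟨X, hX, hXindep, hsum⟩ :=
    SensorNet.exists_expMeasure_star_dotProduct_matR_mulVec_eq_sum Ppred ε PT σθ2 σv2 d γ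
      one_ne_zero hlaw hindep
  have hthreshold : 0 < SensorNet.betaCoef Ppred ε * σw2 / PT :=
    div_pos (mul_pos (SensorNet.betaCoef_pos hε hεP) hσw) hPT
  simp_rw [SensorNet.lt_filteredMSE_equalGain_channel_iff hσθ hσw hPT hσv hd hε hεP, hsum,
    Complex.ofReal_re]
  rw [SensorNet.measureReal_sum_mul_lt_of_hasLaw_expMeasure (by simp) hX hXindep
    (fun i hi => (hneg i hi).le) hthreshold, Fintype.card_fin]
  have hexponent : ∀ lam : ℝ, ((1⁻¹ : ℝ≥0) : ℝ) * (SensorNet.betaCoef Ppred ε * σw2 / PT) / lam =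
      (Ppred - ε) * σw2 / (ε * Ppred * PT * lam) := by
    intro lam
    rw [inv_one, NNReal.coe_one, one_mul, SensorNet.betaCoef, div_mul_eq_mul_div, div_div, div_div,
      ← mul_assoc (ε * Ppred)]
  rw [hexponent]
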